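/- **Setting.** Let $d\ge 0$ be an integer and let $|\cdot|$ be the Euclidean norm. * *Data.* $g:\mathbb R^{d+1}\to\mathbb R^{d+1}$ and $f:\mathbb R^{d+1}\to\mathbb R$ are such that $(g,f)$ is $L$-Lipschitz for the Euclidean norms, with $L<1$. The noises $(\epsilon_k,\eta_k)_{k\ge0}$ in $\mathbb R^{d+1}\times\mathbb R$ are i.i.d. copies of a pair $(\epsilon,\eta)$ that has mean zero and is almost surely bounded ($\epsilon$ and $\eta$ may be dependent). For every $(x,z)\in\mathbb R^d\times\mathbb R$ with $|(x,z)|\le 1$, almost surely $|g(x,z)+\epsilon|\le 1$ and $|f(x,z)+\eta|\le C_y$, where $C_y$ is a constant. * *Activation.* $\sigma\in C^2(\mathbb R)$ satisfies $|\sigma|\le 1$, $|\sigma'|\le C_\sigma$ and $|\sigma''|\le C_\sigma$, where $C_\sigma^2<\min\{\tfrac12,\tfrac{1-L^2}{8}\}$. * *Parameters.* $\lambda(dc,dw,db)$ is a probability measure on $\mathbb R\times\mathbb R^d\times\mathbb R$, absolutely continuous with respect to Lebesgue measure. Under $\lambda$, $c$ and $w$ are independent, $c$ has mean zero, $|c|\le1$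 and $|b|\le1$ almost surely, and $\int|w|^2\,d\lambda\le1$. Let $H^1(\lambda)$ be the completion of the space of $C^1$ functions $h$ on $\mathbb R^d$ with finite norm $\|h\|_{H^1(\lambda)}^2=\int(|h(w)|^2+|\nabla h(w)|^2)\,\lambda(dw)$, functions at distance zero being identified. Let $\overline{\mathcal H}$ be the closure in $H^1(\lambda)$ of $\mathcal H=\{w\mapsto\sigma(w^\top a+b): a\in\mathbb R^d,\ |a|\le1,\ b\in\mathbb R\}$. Let $$\mathcal X=\{(x,z):|(x,z)|\le1\}\times[-C_y,C_y]\times\overline{\mathcal H},\qquad \|(x,z,y,h)\|_{\mathcal X}^2=|x|^2+|z|^2+|y|^2+\|h\|_{H^1(\lambda)}^2,$$ with the Borel $\sigma$-algebra of this norm. The auxiliary memory chain $H_k=(X_k,Z_k,Y_k,h_k)$ is the $\mathcal X$-valued Markov chain $H_{k+1}=F(H_k,\epsilon_k,\eta_k)$ (almost surely), where $H_0$ is independent of the noises and $$F(x,z,y,h,\epsilon,\eta)=\Big(g(x,z)+\epsilon,\ f(x,z)+\eta,\ \big[w\mapsto\sigma\big(w^\top x+\textstyle\int b'h(w')\,\lambda(dc',dw',db')\big)\big]\Big).$$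 Its law at time $k$ is $\mu_k$. Let $P(H,A)=\mathbb P(F(H,\epsilon,\eta)\in A)$ and $P^\vee(\mu)=\int P(H,\cdot)\,\mu(dH)$. Let $\mathcal P_2(\mathcal X)$ be the set of probability measures $\mu$ on $\mathcal X$ with $\int\|u\|_{\mathcal X}^2\,\mu(du)<\infty$, and let $$\mathsf{Wass}_2(\mu,\nu)^2=\inf_{\gamma}\int\|u-v\|_{\mathcal X}^2\,\gamma(du\,dv),$$ the infimum being over all couplings $\gamma$ of $\mu$ and $\nu$. Put $q_0=\sqrt{L^2+8C_\sigma^2}$. **Theorem.** $P$ is a Markov kernel on $\mathcal X$, $q_0<1$, $P^\vee$ maps $\mathcal P_2(\mathcal X)$ into itself, and for all $\mu,\nu\in\mathcal P_2(\mathcal X)$ $$\mathsf{Wass}_2(P^\vee(\mu),P^\vee(\nu))\le q_0\,\mathsf{Wass}_2(\mu,\nu).$$ Moreover there is $\mu\in\mathcal P_2(\mathcal X)$ with $P^\vee(\mu)=\mu$, and it is the only probability measure on $\mathcal X$ fixed by $P^\vee$, i.e. the unique stationary measure of the chain. For every probability measure $\mu_0$ on $\mathcal X$ and every $k\ge0$,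 $$\mathsf{Wass}_2((P^\vee)^k\mu_0,\mu)\le q_0^k\,\mathsf{Wass}_2(\mu_0,\mu)<\infty.$$ For every such chain $(H_k)$ one has $\mu_k=(P^\vee)^k\mu_0$; hence $\mathsf{Wass}_2(\mu_k,\mu)\le q_0^k\,\mathsf{Wass}_2(\mu_0,\mu)\to0$. -/

import Mathlib

open MeasureTheory ProbabilityTheory Filter Topology
open scoped ENNReal NNReal Gradient

noncomputable section

namespace RNN

/-- The weight space `ℝ^d` with its Euclidean norm. -/
abbrev Vec (d : ℕ) : Type := EuclideanSpace ℝ (Fin d)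

/-- The space `ℝ^{d+1} = ℝ^d × ℝ` of pairs `(x, z)` with its Euclidean norm. -/
abbrev Pair (d : ℕ) : Type := WithLp 2 (Vec d × ℝ)

/-! ### The weighted Sobolev space `H¹(ρ)` -/

/-- Pairs (function, vector field) in `L²(ρ) × L²(ρ; ℝ^d)` with the Hilbert norm
`‖(u, U)‖² = ∫ |u|² + |U|² dρ`. -/
abbrev L2Pair {d : ℕ} (ρ : Measure (Vec d)) : Type :=
  WithLp 2 (Lp ℝ 2 ρ × Lp (Vec d) 2 ρ)

/-- The pairs `(v, ∇v)` with `v` continuously differentiable and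
`∫ |v|² + |∇v|² dρ < ∞`. -/
def C1Pairs {d : ℕ} (ρ : Measure (Vec d)) : Submodule ℝ (L2Pair ρ) where
  carrier := {p | ∃ v : Vec d → ℝ, ContDiff ℝ 1 v ∧ p.fst =ᵐ[ρ] v ∧ p.snd =ᵐ[ρ] ∇ v}
  zero_mem' := by
    refine ⟨fun _ => 0, contDiff_const, ?_, ?_⟩
    · exact Lp.coeFn_zero _ _ _
    · refine (Lp.coeFn_zero _ _ _).trans (Eventually.of_forall fun w => ?_)
      simp [gradient]
  add_mem' := by
    rintro p q ⟨v, hv, h1, h2⟩ ⟨u, hu, k1, k2⟩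
    refine ⟨v + u, hv.add hu, ?_, ?_⟩
    · exact (Lp.coeFn_add _ _).trans (h1.add k1)
    · refine (Lp.coeFn_add _ _).trans ((h2.add k2).trans (Eventually.of_forall fun w => ?_))
      have e := fderiv_add (hv.differentiable one_ne_zero w) (hu.differentiable one_ne_zero w)
      simp [gradient, e]
  smul_mem' := by
    rintro c p ⟨v, hv, h1, h2⟩
    refine ⟨c • v, hv.const_smul c, ?_, ?_⟩
    · exact (Lp.coeFn_smul _ _).trans (h1.const_smul c)
    · refine (Lp.coeFn_smul _ _).trans ((h2.const_smul c).trans (Eventually.of_forall fun w => ?_))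
      have e := fderiv_const_smul (hv.differentiable one_ne_zero w) c
      simp [gradient, e]

/-- `H¹(ρ)`: the completion of the `C¹` functions `v` with `∫ |v|² + |∇v|² dρ < ∞` for the
norm `‖v‖² = ∫ |v|² + |∇v|² dρ`, realised as the closure of the pairs `(v, ∇v)`. -/
abbrev H1 {d : ℕ} (ρ : Measure (Vec d)) : Type :=
  ↥(C1Pairs ρ).topologicalClosure

/-- The element of `L²(ρ)` underlying an element of `H¹(ρ)`. -/
def H1.toFun {d : ℕ} {ρ : Measure (Vec d)} (h : H1 ρ) : Lp ℝ 2 ρ := (h : L2Pair ρ).fst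

/-- A `C¹` function with finite `H¹(ρ)` norm as an element of `H¹(ρ)`. -/
def H1.ofC1 {d : ℕ} {ρ : Measure (Vec d)} (v : Vec d → ℝ) (hv : ContDiff ℝ 1 v)
    (h0 : MemLp v 2 ρ) (h1 : MemLp (∇ v) 2 ρ) : H1 ρ :=
  ⟨WithLp.toLp 2 (h0.toLp v, h1.toLp (∇ v)),
    Submodule.le_topologicalClosure _ ⟨v, hv, h0.coeFn_toLp, h1.coeFn_toLp⟩⟩

/-! ### Wasserstein distance -/

section Wasserstein

variable {X : Type*} [MeasurableSpace X]

/-- Couplings of two measures. -/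
def Couplings (μ ν : Measure X) : Set (Measure (X × X)) :=
  {γ | γ.map Prod.fst = μ ∧ γ.map Prod.snd = ν}

/-- The 2-Wasserstein distance `(inf_γ ∫ d(u,v)² γ(du dv))^{1/2}`, with values in `[0, ∞]`. -/
def wass2 [PseudoEMetricSpace X] (μ ν : Measure X) : ℝ≥0∞ :=
  (⨅ γ ∈ Couplings μ ν, ∫⁻ p, edist p.1 p.2 ^ 2 ∂γ) ^ (1 / 2 : ℝ)

end Wasserstein

/-! ### The model -/

/-- The data of the model and its standing assumptions. -/
structure MemoryModel (d : ℕ) where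
  /-- drift of the input sequence -/
  g : Pair d → Pair d
  /-- output map -/
  f : Pair d → ℝ
  /-- Lipschitz constant of `(g, f)` -/
  L : ℝ
  L_lt_one : L < 1
  lipschitz : ∀ u v : Pair d,
    ‖(WithLp.toLp 2 (g u - g v, f u - f v) : WithLp 2 (Pair d × ℝ))‖ ≤ L * ‖u - v‖
  /-- common law of the noises `(ε_k, η_k)`; `ε_k` and `η_k` may be dependent -/
  noise : Measure (Pair d × ℝ)
  noise_prob : IsProbabilityMeasure noise
  /-- bound on the noises -/
  Cε : ℝ
  noise_bdd : ∀ᵐ ξ ∂noise, ‖ξ.1‖ ≤ Cε ∧ |ξ.2| ≤ Cε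
  noise_mean_fst : ∫ ξ, ξ.1 ∂noise = 0
  noise_mean_snd : ∫ ξ, ξ.2 ∂noise = 0
  /-- the input dynamics stays in the closed unit ball -/
  input_bdd : ∀ u : Pair d, ‖u‖ ≤ 1 → ∀ᵐ ξ ∂noise, ‖g u + ξ.1‖ ≤ 1
  /-- bound on the outputs -/
  Cy : ℝ
  output_bdd : ∀ u : Pair d, ‖u‖ ≤ 1 → ∀ᵐ ξ ∂noise, |f u + ξ.2| ≤ Cy
  /-- activation function -/
  σ : ℝ → ℝ
  σ_contDiff : ContDiff ℝ 2 σ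
  σ_bdd : ∀ t, |σ t| ≤ 1
  /-- bound on the first two derivatives of `σ` -/
  Cσ : ℝ
  deriv_σ_bdd : ∀ t, |deriv σ t| ≤ Cσ
  deriv2_σ_bdd : ∀ t, |deriv (deriv σ) t| ≤ Cσ
  Cσ_sq_lt : Cσ ^ 2 < min (1 / 2) ((1 - L ^ 2) / 8)
  /-- law of the initial parameters `(c, w, b)` -/
  lam : Measure (ℝ × Vec d × ℝ)
  lam_prob : IsProbabilityMeasure lam
  lam_ac : lam ≪ volume
  lam_indep : IndepFun (fun θ : ℝ × Vec d × ℝ => θ.1) (fun θ => θ.2.1) lam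
  lam_mean_c : ∫ θ, θ.1 ∂lam = 0
  lam_c_bdd : ∀ᵐ θ ∂lam, |θ.1| ≤ 1
  lam_b_bdd : ∀ᵐ θ ∂lam, |θ.2.2| ≤ 1
  lam_w_sq : ∫⁻ θ, ‖θ.2.1‖ₑ ^ 2 ∂lam ≤ 1

namespace MemoryModel

variable {d : ℕ} (M : MemoryModel d)

/-- The constant `q₀ = √(L² + 8 C_σ²)`. -/
def q₀ : ℝ := √(M.L ^ 2 + 8 * M.Cσ ^ 2)

/-- The law of `w` under `λ`. -/
def lamW : Measure (Vec d) := M.lam.map (fun θ => θ.2.1)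

instance : IsProbabilityMeasure M.lamW :=
  haveI := M.lam_prob
  Measure.isProbabilityMeasure_map (by fun_prop)

/-- The function `w ↦ σ(wᵀ a + b)`. -/
def ridgeFun (a : Vec d) (b : ℝ) (w : Vec d) : ℝ := M.σ (inner ℝ w a + b)

lemma contDiff_ridgeFun (a : Vec d) (b : ℝ) : ContDiff ℝ 1 (M.ridgeFun a b) := by
  have h1 : ContDiff ℝ 1 M.σ := M.σ_contDiff.of_le (by norm_num)
  exact h1.comp ((contDiff_id.inner ℝ contDiff_const).add contDiff_const)

lemma gradient_ridgeFun (a : Vec d) (b : ℝ) :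
    ∇ (M.ridgeFun a b) = fun w => deriv M.σ (inner ℝ w a + b) • a := by
  refine gradient_eq fun w => ?_
  rw [hasGradientAt_iff_hasFDerivAt]
  have hd : HasDerivAt M.σ (deriv M.σ (inner ℝ w a + b)) (inner ℝ w a + b) :=
    ((M.σ_contDiff.differentiable (by norm_num)) _).hasDerivAt
  have hi : HasFDerivAt (fun w : Vec d => (inner ℝ w a : ℝ) + b) (innerSL ℝ a) w := by
    have := ((innerSL ℝ a).hasFDerivAt (x := w)).add_const b
    simpa [real_inner_comm] using this
  have := hd.comp_hasFDerivAt w hi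
  have e : InnerProductSpace.toDual ℝ (Vec d) (deriv M.σ (inner ℝ w a + b) • a)
      = deriv M.σ (inner ℝ w a + b) • innerSL ℝ a := by
    ext y
    simp
  rw [e]
  exact this

lemma memLp_ridgeFun (a : Vec d) (b : ℝ) : MemLp (M.ridgeFun a b) 2 M.lamW :=
  MemLp.of_bound (M.contDiff_ridgeFun a b).continuous.aestronglyMeasurable 1
    (Eventually.of_forall fun _ => M.σ_bdd _)

lemma memLp_gradient_ridgeFun (a : Vec d) (b : ℝ) :
    MemLp (∇ (M.ridgeFun a b)) 2 M.lamW := by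
  rw [gradient_ridgeFun]
  have hc : Continuous (deriv M.σ) := M.σ_contDiff.continuous_deriv (by norm_num)
  refine MemLp.of_bound (Continuous.aestronglyMeasurable (by fun_prop)) (M.Cσ * ‖a‖)
    (Eventually.of_forall fun w => ?_)
  rw [norm_smul]
  exact mul_le_mul_of_nonneg_right (M.deriv_σ_bdd _) (norm_nonneg _)

/-- The function `w ↦ σ(wᵀ a + b)` as an element of `H¹(λ)`. -/
def ridge (a : Vec d) (b : ℝ) : H1 M.lamW :=
  H1.ofC1 (M.ridgeFun a b) (M.contDiff_ridgeFun a b) (M.memLp_ridgeFun a b)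
    (M.memLp_gradient_ridgeFun a b)

/-- The set `ℋ` of functions `w ↦ σ(wᵀ a + b)` with `|a| ≤ 1`, `b ∈ ℝ`. -/
def hidden : Set (H1 M.lamW) := {h | ∃ (a : Vec d) (b : ℝ), ‖a‖ ≤ 1 ∧ h = M.ridge a b}

/-- The space of all `((x, z), (y, h))` with
`‖(x, z, y, h)‖² = |x|² + |z|² + |y|² + ‖h‖²_{H¹(λ)}`. -/
abbrev Ambient : Type := WithLp 2 (Pair d × WithLp 2 (ℝ × H1 M.lamW))

/-- The set `B̄₁(0) × [-C_y, C_y] × ℋ̄`, the closure being taken in `H¹(λ)`. -/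
def stateSet : Set M.Ambient :=
  {p | ‖p.fst‖ ≤ 1 ∧ |p.snd.fst| ≤ M.Cy ∧ p.snd.snd ∈ closure M.hidden}

/-- The state space `𝒳`, with the metric induced by the norm. -/
abbrev State : Type := ↥M.stateSet

/-- `𝒳` carries its Borel `σ`-algebra. -/
instance : MeasurableSpace M.State := borel M.State

instance : BorelSpace M.State := ⟨rfl⟩

/-- `⟨b h(w), λ⟩ = ∫ b h(w) λ(dc, dw, db)`. -/
def pairing (h : H1 M.lamW) : ℝ := ∫ θ, θ.2.2 * h.toFun θ.2.1 ∂M.lam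

/-- The memory update `ς(x, z, y, h) = [w ↦ σ(wᵀ x + ⟨b h(w), λ⟩)]`. -/
def memoryUpdate (p : M.Ambient) : H1 M.lamW := M.ridge p.fst.fst (M.pairing p.snd.snd)

/-- `F(x, z, y, h, ε, η) = (g(x, z) + ε, f(x, z) + η, ς(x, z, y, h))`. -/
def F (p : M.Ambient) (ξ : Pair d × ℝ) : M.Ambient :=
  WithLp.toLp 2 (M.g p.fst + ξ.1, WithLp.toLp 2 (M.f p.fst + ξ.2, M.memoryUpdate p))

open Classical in
/-- `F` as a map into `𝒳`. For each state the value of `F` lies in `𝒳` for almost every noise;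
on the exceptional null set of noises the state is left unchanged. -/
def step (H : M.State) (ξ : Pair d × ℝ) : M.State :=
  if h : M.F H ξ ∈ M.stateSet then ⟨M.F H ξ, h⟩ else H

/-- The transition kernel `P(H, A) = 𝔼[1_A(F(H, ε, η))]`. -/
def transition (H : M.State) : Measure M.State := M.noise.map (M.step H)

/-- The operator `P^∨(μ) = ∫ P(H, ·) μ(dH)` on measures. -/
def dual (μ : Measure M.State) : Measure M.State := μ.bind M.transition

/-- `𝒫₂(𝒳)`: the probability measures on `𝒳` with `∫ ‖u‖² dμ < ∞`. -/
def P2 : Set (Measure M.State) :=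
  {μ | IsProbabilityMeasure μ ∧ ∫⁻ u, ‖(u : M.Ambient)‖ₑ ^ 2 ∂μ < ∞}

/-- `(H_k)` is a Markov chain in `𝒳` with `H_{k+1} = F(H_k, ε_k, η_k)`, driven by iid noises
`ξ_k = (ε_k, η_k)` that are independent of `H_0`. -/
structure IsMemoryChain {Ω : Type*} [MeasurableSpace Ω] (P : Measure Ω)
    (H : ℕ → Ω → M.State) (ξ : ℕ → Ω → Pair d × ℝ) : Prop where
  measurable_state : ∀ k, Measurable (H k)
  measurable_noise : ∀ k, Measurable (ξ k)
  indep_noise : iIndepFun ξ P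
  law_noise : ∀ k, P.map (ξ k) = M.noise
  indep_init : IndepFun (H 0) (fun ω k => ξ k ω) P
  recursion : ∀ k, ∀ᵐ ω ∂P, (H (k + 1) ω : M.Ambient) = M.F (H k ω) (ξ k ω)

end MemoryModel

end RNN

end

/-! ### Wasserstein distance -/

namespace RNN

section Wass

variable {X : Type*} [MeasurableSpace X]

/-! The chain is a random contraction of a bounded complete separable space. The noise enters `F`
additively, so two states moved by the same noise differ by an amount independent of it. The drift
contributes `L²` to the squared Lipschitz constant. The ridge function depends on `x` and on the
pairing with `h`, and contributes `8 C_σ²`. Their sum is `q₀² < 1` (`norm_F_sub_sq_le`). Pushing an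
arbitrary coupling forward by a common noise gives the Wasserstein contraction
(`wass2_bind_map_le`).

Existence does not use completeness of the Wasserstein space. Composing the random maps so that the
newest noise acts innermost gives, for almost every noise sequence, a Cauchy sequence of states. Its
limit `B` satisfies `B(ω) = s(B(shift ω), ω 0)`, where `shift ω` and `ω 0` are independent, so the
law of `B` is stationary (`exists_stationary`).

Since the space is bounded, all distances between probability measures are finite. The contraction
then forces two stationary laws to be at distance zero, hence equal (`eq_of_wass2_eq_zero`), and
iterating it gives the geometric rate. A chain is almost surely the forward iterate of its initial
state, which identifies its laws (`map_chain`). -/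

lemma wass2_le_of_coupling [PseudoEMetricSpace X] {μ ν : Measure X} {γ : Measure (X × X)}
    (hγ : γ ∈ Couplings μ ν) :
    wass2 μ ν ≤ (∫⁻ p, edist p.1 p.2 ^ 2 ∂γ) ^ (1 / 2 : ℝ) :=
  ENNReal.rpow_le_rpow (iInf₂_le γ hγ) (by norm_num)

lemma prod_mem_couplings (μ ν : Measure X) [IsProbabilityMeasure μ] [IsProbabilityMeasure ν] :
    μ.prod ν ∈ Couplings μ ν := by
  constructor <;> simp [Measure.map_fst_prod, Measure.map_snd_prod]

/-- On a bounded space all Wasserstein distances between probability measures are finite. -/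
lemma wass2_lt_top [PseudoEMetricSpace X] {D : ℝ≥0} (hD : ∀ x y : X, edist x y ≤ D)
    (μ ν : Measure X) [IsProbabilityMeasure μ] [IsProbabilityMeasure ν] : wass2 μ ν < ∞ := by
  refine (wass2_le_of_coupling (prod_mem_couplings μ ν)).trans_lt ?_
  refine ENNReal.rpow_lt_top_of_nonneg (by norm_num) (ne_of_lt ?_)
  calc ∫⁻ p, edist p.1 p.2 ^ 2 ∂(μ.prod ν) ≤ ∫⁻ _, (D : ℝ≥0∞) ^ 2 ∂(μ.prod ν) :=
        lintegral_mono fun p => by gcongr; exact hD _ _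
    _ < ∞ := by simp

variable [PseudoEMetricSpace X] [BorelSpace X] [SecondCountableTopology X]

/-- Under a nearly optimal coupling the two coordinates are rarely more than `δ` apart, by Markov's
inequality, so `μ C` is at most the `ν`-mass of the `δ`-thickening of `C`. Letting `δ` tend to zero
recovers `C` itself because `C` is closed. No optimal coupling is needed. -/
lemma measure_closed_le_of_coupling_inf_eq_zero {μ ν : Measure X}
    [IsFiniteMeasure ν] (h : ⨅ γ ∈ Couplings μ ν, ∫⁻ p, edist p.1 p.2 ^ 2 ∂γ = 0)
    {C : Set X} (hC : IsClosed C) : μ C ≤ ν C := by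
  have key : ∀ δ : ℝ, 0 < δ → μ C ≤ ν (Metric.cthickening δ C) := by
    intro δ hδ
    have hδ2 : ENNReal.ofReal δ ^ 2 ≠ 0 := by simpa using hδ
    have hδt : ENNReal.ofReal δ ^ 2 ≠ ∞ := by simp
    refine ENNReal.le_of_forall_pos_le_add fun ε hε _ => ?_
    -- The threshold `δ² ε` is chosen so that Markov's inequality bounds the mass of pairs at
    -- distance at least `δ` by `ε`.
    have hpos : (⨅ γ ∈ Couplings μ ν, ∫⁻ p, edist p.1 p.2 ^ 2 ∂γ) < ENNReal.ofReal δ ^ 2 * ε := by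
      rw [h]
      exact ENNReal.mul_pos hδ2 (by simpa using hε.ne')
    simp only [iInf_lt_iff] at hpos
    obtain ⟨γ, ⟨h1, h2⟩, hγ⟩ := hpos
    have hm : Measurable fun p : X × X => edist p.1 p.2 ^ 2 := by fun_prop
    have hmark := mul_meas_ge_le_lintegral (μ := γ) hm (ENNReal.ofReal δ ^ 2)
    have hsmall : γ {p | ENNReal.ofReal δ ^ 2 ≤ edist p.1 p.2 ^ 2} ≤ ε :=
      (ENNReal.mul_le_mul_iff_right hδ2 hδt).1 (hmark.trans hγ.le)
    rw [← h1, ← h2, Measure.map_apply measurable_fst hC.measurableSet,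
      Measure.map_apply measurable_snd Metric.isClosed_cthickening.measurableSet]
    refine (measure_mono ?_).trans ((measure_union_le _ _).trans (add_le_add_right hsmall _))
    intro p hp
    by_cases hd : ENNReal.ofReal δ ≤ edist p.1 p.2
    · right
      exact pow_le_pow_left' hd 2
    · left
      simp only [Set.mem_preimage, Metric.mem_cthickening_iff]
      refine (Metric.infEDist_le_edist_of_mem (y := p.1) hp).trans ?_
      rw [edist_comm]
      exact (not_le.1 hd).le
  have ht := tendsto_measure_cthickening_of_isClosed (μ := ν) (s := C)
    ⟨1, one_pos, measure_ne_top _ _⟩ hC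
  refine ge_of_tendsto (ht.mono_left (nhdsWithin_le_nhds (s := Set.Ioi 0))) ?_
  filter_upwards [self_mem_nhdsWithin] with δ hδ using key δ hδ

lemma eq_of_wass2_eq_zero {μ ν : Measure X} [IsProbabilityMeasure μ] [IsProbabilityMeasure ν]
    (h : wass2 μ ν = 0) : μ = ν := by
  have h0 : ⨅ γ ∈ Couplings μ ν, ∫⁻ p, edist p.1 p.2 ^ 2 ∂γ = 0 := by
    simpa using (ENNReal.rpow_eq_zero_iff_of_pos (by norm_num)).1 h
  have h1 : ⨅ γ ∈ Couplings ν μ, ∫⁻ p, edist p.1 p.2 ^ 2 ∂γ = 0 := by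
    rw [← nonpos_iff_eq_zero, ← h0]
    refine le_iInf₂ fun γ hγ => ?_
    have hswap : γ.map Prod.swap ∈ Couplings ν μ := by
      constructor
      · rw [Measure.map_map measurable_fst measurable_swap]; exact hγ.2
      · rw [Measure.map_map measurable_snd measurable_swap]; exact hγ.1
    refine (iInf₂_le _ hswap).trans ?_
    have hm : Measurable fun p : X × X => edist p.1 p.2 ^ 2 := by fun_prop
    rw [lintegral_map hm measurable_swap]
    simp [edist_comm]
  refine ext_of_generate_finite _ (borel_eq_generateFrom_isClosed (α := X) ▸ BorelSpace.measurable_eq)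
    isPiSystem_isClosed (fun C hC => ?_) (by simp)
  exact le_antisymm (measure_closed_le_of_coupling_inf_eq_zero h0 hC)
    (measure_closed_le_of_coupling_inf_eq_zero h1 hC)

end Wass

/-! ### Random iterated maps -/

section Iterates

variable {X Ξ : Type*}

/-- The composition of the random maps driven by `ω 0, …, ω (k - 1)`, with `ω 0` acting first. -/
def forwardIter (s : X → Ξ → X) : ℕ → X → (ℕ → Ξ) → X
  | 0, x, _ => x
  | k + 1, x, ω => forwardIter s k (s x (ω 0)) (fun n => ω (n + 1))

/-- The composition of the random maps driven by `ω 0, …, ω (k - 1)`, with `ω 0` acting last. -/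
def backwardIter (s : X → Ξ → X) : ℕ → X → (ℕ → Ξ) → X
  | 0, x, _ => x
  | k + 1, x, ω => s (backwardIter s k x (fun n => ω (n + 1))) (ω 0)

/-- The definition peels off the first map, which suits iterating the operator on laws; the
recursion of a chain appends the last one. -/
lemma forwardIter_succ' (s : X → Ξ → X) (k : ℕ) (x : X) (ω : ℕ → Ξ) :
    forwardIter s (k + 1) x ω = s (forwardIter s k x ω) (ω k) := by
  induction k generalizing x ω with
  | zero => rfl
  | succ k ih => exact ih (s x (ω 0)) fun n => ω (n + 1)

end Iterates

/-! ### Laws of random iterates, synchronous coupling and stationary laws -/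

section RandomMaps

variable {X Ξ : Type*} [MeasurableSpace X] [MeasurableSpace Ξ]

lemma infinitePi_map_head_tail (π : Measure Ξ) [IsProbabilityMeasure π] :
    (Measure.infinitePi fun _ : ℕ => π).map (fun ω => (ω 0, fun n => ω (n + 1)))
      = π.prod (Measure.infinitePi fun _ : ℕ => π) := by
  -- `c` prepends a head to a sequence. Its pushforward is identified on finite-dimensional boxes;
  -- splitting into head and tail then undoes `c`.
  let c : Ξ × (ℕ → Ξ) → ℕ → Ξ := fun p n => Nat.casesOn n p.1 p.2
  have hc : Measurable c := by
    refine measurable_pi_iff.2 fun n => ?_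
    cases n with
    | zero => exact measurable_fst
    | succ n => exact (measurable_pi_apply n).comp measurable_snd
  have hcons : (π.prod (Measure.infinitePi fun _ : ℕ => π)).map c
      = Measure.infinitePi fun _ : ℕ => π := by
    refine Measure.eq_infinitePi _ fun s t ht => ?_
    rw [Measure.map_apply hc (MeasurableSet.pi s.countable_toSet fun i _ => ht i)]
    classical
    have hpre : c ⁻¹' (Set.pi s t)
        = (if 0 ∈ s then t 0 else Set.univ) ×ˢ
          Set.pi (s.preimage Nat.succ Nat.succ_injective.injOn : Finset ℕ) (fun n => t (n + 1)) := by
      ext p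
      simp only [Set.mem_preimage, Set.mem_pi, Set.mem_prod, Finset.mem_coe, Finset.mem_preimage]
      constructor
      · intro h
        refine ⟨?_, fun n hn => h (n + 1) hn⟩
        split_ifs with h0
        · exact h 0 h0
        · trivial
      · rintro ⟨h0, h1⟩ n hn
        cases n with
        | zero => rwa [if_pos hn] at h0
        | succ n => exact h1 n hn
    rw [hpre, Measure.prod_prod, Measure.infinitePi_pi _ fun i _ => ht (i + 1)]
    have hprod := Finset.prod_preimage' Nat.succ s Nat.succ_injective.injOn fun i => π (t i)
    simp only [Nat.succ_eq_add_one] at hprod ⊢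
    rw [hprod]
    have hr : ∀ x : ℕ, x ∈ Set.range (fun n => n + 1) ↔ x ≠ 0 := fun x => by
      cases x <;> simp
    by_cases h0 : 0 ∈ s
    · rw [if_pos h0, ← Finset.mul_prod_erase s _ h0]
      congr 2
      ext x
      simp only [Finset.mem_filter, Finset.mem_erase]
      exact (and_congr_right fun _ => hr x).trans and_comm
    · rw [if_neg h0, measure_univ, one_mul]
      congr 1
      ext x
      simp only [Finset.mem_filter]
      exact ⟨And.left, fun hx => ⟨hx, (hr x).2 fun h => h0 (h ▸ hx)⟩⟩
  conv_lhs => rw [← hcons]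
  rw [Measure.map_map (by fun_prop) hc]
  exact Measure.map_id

lemma measurable_map_apply {s : X → Ξ → X} (hs : Measurable (Function.uncurry s))
    (π : Measure Ξ) [IsProbabilityMeasure π] : Measurable fun x => π.map (s x) := by
  have e : (fun x => π.map (s x)) = fun x => (π.map (Prod.mk x)).map (Function.uncurry s) := by
    funext x
    rw [Measure.map_map hs measurable_prodMk_left]
    rfl
  rw [e]
  exact (Measure.measurable_map _ hs).comp Measurable.map_prodMk_left

/-- By Fubini, one kernel step is a pushforward of state and independent noise, the form in which
couplings can be built. -/
lemma bind_map_eq_map_prod {s : X → Ξ → X} (hs : Measurable (Function.uncurry s))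
    (π : Measure Ξ) [IsProbabilityMeasure π] (μ : Measure X) :
    μ.bind (fun x => π.map (s x)) = (μ.prod π).map (Function.uncurry s) := by
  ext A hA
  rw [Measure.bind_apply hA (measurable_map_apply hs π).aemeasurable,
    Measure.map_apply hs hA, Measure.prod_apply (hs hA)]
  refine lintegral_congr fun x => ?_
  exact Measure.map_apply (hs.comp measurable_prodMk_left) hA

lemma isProbabilityMeasure_bind_map {s : X → Ξ → X} (hs : Measurable (Function.uncurry s))
    (π : Measure Ξ) [IsProbabilityMeasure π] (μ : Measure X) [IsProbabilityMeasure μ] :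
    IsProbabilityMeasure (μ.bind (fun x => π.map (s x))) := by
  rw [bind_map_eq_map_prod hs]
  exact Measure.isProbabilityMeasure_map hs.aemeasurable

lemma wass2_bind_map_le [PseudoEMetricSpace X] [BorelSpace X] [SecondCountableTopology X]
    {s : X → Ξ → X} (hs : Measurable (Function.uncurry s))
    (π : Measure Ξ) [IsProbabilityMeasure π] {q : ℝ≥0}
    (hq : ∀ᵐ ξ ∂π, LipschitzWith q fun x => s x ξ) (μ ν : Measure X)
    [IsProbabilityMeasure μ] [IsProbabilityMeasure ν] :
    wass2 (μ.bind (fun x => π.map (s x))) (ν.bind (fun x => π.map (s x))) ≤ q * wass2 μ ν := by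
  rw [bind_map_eq_map_prod hs, bind_map_eq_map_prod hs]
  have hq' : (q : ℝ≥0∞) = ((q : ℝ≥0∞) ^ 2) ^ (1 / 2 : ℝ) := by
    rw [← ENNReal.rpow_natCast, ← ENNReal.rpow_mul]
    norm_num
  rw [wass2, wass2, hq', ← ENNReal.mul_rpow_of_nonneg _ _ (by norm_num)]
  refine ENNReal.rpow_le_rpow ?_ (by norm_num)
  rw [iInf_subtype', iInf_subtype']
  have : Nonempty (Couplings μ ν) := ⟨⟨_, prod_mem_couplings μ ν⟩⟩
  rw [ENNReal.mul_iInf (fun h => absurd h (by simp))]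
  refine le_iInf fun ⟨γ, h1, h2⟩ => ?_
  have : IsProbabilityMeasure (γ.map Prod.fst) := h1 ▸ inferInstance
  have : IsProbabilityMeasure γ := Measure.isProbabilityMeasure_of_map Prod.fst
  -- Synchronous coupling: both states are moved by the same noise, so the Lipschitz bound applies
  -- for almost every noise.
  let T : (X × X) × Ξ → X × X := fun p => (s p.1.1 p.2, s p.1.2 p.2)
  have hT1 : Measurable fun p : (X × X) × Ξ => (p.1.1, p.2) := by fun_prop
  have hT2 : Measurable fun p : (X × X) × Ξ => (p.1.2, p.2) := by fun_prop
  have hT : Measurable T := (hs.comp hT1).prodMk (hs.comp hT2)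
  have hc : (γ.prod π).map T ∈ Couplings ((μ.prod π).map (Function.uncurry s))
      ((ν.prod π).map (Function.uncurry s)) := by
    constructor
    · have e : μ.prod π = (γ.prod π).map fun p => (p.1.1, p.2) := by
        have := Measure.map_prod_map γ π measurable_fst (measurable_id (α := Ξ))
        rw [h1, Measure.map_id] at this
        exact this
      rw [e, Measure.map_map measurable_fst hT, Measure.map_map hs hT1]
      rfl
    · have e : ν.prod π = (γ.prod π).map fun p => (p.1.2, p.2) := by
        have := Measure.map_prod_map γ π measurable_snd (measurable_id (α := Ξ))
        rw [h2, Measure.map_id] at this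
        exact this
      rw [e, Measure.map_map measurable_snd hT, Measure.map_map hs hT2]
      rfl
  refine (iInf_le _ ⟨_, hc⟩).trans ?_
  have hm : Measurable fun p : X × X => edist p.1 p.2 ^ 2 := by fun_prop
  rw [lintegral_map hm hT, lintegral_prod _ (show Measurable fun p => edist (T p).1 (T p).2 ^ 2 from
    hm.comp hT).aemeasurable, ← lintegral_const_mul _ hm]
  refine lintegral_mono fun p => ?_
  calc ∫⁻ ξ, edist (s p.1 ξ) (s p.2 ξ) ^ 2 ∂π
      ≤ ∫⁻ _, (q : ℝ≥0∞) ^ 2 * edist p.1 p.2 ^ 2 ∂π := by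
        refine lintegral_mono_ae (hq.mono fun ξ hξ => ?_)
        rw [← mul_pow]
        exact pow_le_pow_left' (hξ p.1 p.2) 2
    _ = _ := by simp

lemma measurable_forwardIter {s : X → Ξ → X} (hs : Measurable (Function.uncurry s)) (k : ℕ) :
    Measurable (Function.uncurry (forwardIter s k)) := by
  induction k with
  | zero => exact measurable_fst
  | succ k ih =>
    have h : Measurable fun p : X × (ℕ → Ξ) => (p.1, p.2 0) := by fun_prop
    have ht : Measurable fun p : X × (ℕ → Ξ) => fun n => p.2 (n + 1) := by fun_prop
    exact ih.comp ((hs.comp h).prodMk ht)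

lemma measurable_backwardIter {s : X → Ξ → X} (hs : Measurable (Function.uncurry s)) (k : ℕ)
    (x : X) : Measurable (backwardIter s k x) := by
  induction k with
  | zero => exact measurable_const
  | succ k ih =>
    have h0 : Measurable fun ω : ℕ → Ξ => ω 0 := by fun_prop
    have ht : Measurable fun ω : ℕ → Ξ => fun n => ω (n + 1) := by fun_prop
    exact hs.comp ((ih.comp ht).prodMk h0)

/-- After the first noise is used, the new state and the remaining noises are again independent, and
the tail has the law of the whole sequence; the induction therefore runs over all initial laws. -/
lemma map_forwardIter {s : X → Ξ → X} (hs : Measurable (Function.uncurry s))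
    (π : Measure Ξ) [IsProbabilityMeasure π] (k : ℕ) (μ : Measure X) [IsProbabilityMeasure μ] :
    (μ.prod (Measure.infinitePi fun _ : ℕ => π)).map (Function.uncurry (forwardIter s k))
      = (fun ν : Measure X => ν.bind fun x => π.map (s x))^[k] μ := by
  induction k generalizing μ with
  | zero =>
    change (μ.prod _).map Prod.fst = μ
    simp [Measure.map_fst_prod]
  | succ k ih =>
    have := isProbabilityMeasure_bind_map hs π μ
    rw [Function.iterate_succ_apply, ← ih, bind_map_eq_map_prod hs]
    have hht : Measurable fun ω : ℕ → Ξ => (ω 0, fun n => ω (n + 1)) := by fun_prop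
    set P : Measure (ℕ → Ξ) := Measure.infinitePi fun _ => π with hP
    have e1 := Measure.map_prod_map μ P (measurable_id (α := X)) hht
    have e2 := Measure.map_prod_map (μ.prod π) P hs (measurable_id (α := ℕ → Ξ))
    rw [hP, infinitePi_map_head_tail, Measure.map_id, ← hP] at e1
    rw [Measure.map_id] at e2
    have hs' : Measurable fun p : X × Ξ × (ℕ → Ξ) => (s p.1 p.2.1, p.2.2) :=
      (hs.comp (measurable_fst.prodMk measurable_snd.fst)).prodMk measurable_snd.snd
    have hk := measurable_forwardIter hs k
    have hks : Measurable fun p : X × Ξ × (ℕ → Ξ) => forwardIter s k (s p.1 p.2.1) p.2.2 :=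
      hk.comp hs'
    have e3 : (μ.prod P).map (Function.uncurry (forwardIter s (k + 1)))
        = ((μ.prod P).map (Prod.map id fun ω : ℕ → Ξ => (ω 0, fun n => ω (n + 1)))).map
          (fun p => forwardIter s k (s p.1 p.2.1) p.2.2) := by
      rw [Measure.map_map hks (measurable_id.prodMap hht)]
      rfl
    rw [e3, ← e1, e2, Measure.map_map hk (hs.prodMap measurable_id), ← Measure.prodAssoc_prod,
      Measure.map_map hks MeasurableEquiv.prodAssoc.measurable]
    rfl

/-- A random contraction of a bounded complete space has a stationary law. -/
lemma exists_stationary {X : Type*} [MetricSpace X] [MeasurableSpace X] [BorelSpace X]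
    [SecondCountableTopology X] [CompleteSpace X] [Nonempty X]
    {s : X → Ξ → X} (hs : Measurable (Function.uncurry s))
    (π : Measure Ξ) [IsProbabilityMeasure π] {q : ℝ≥0} (hq1 : q < 1)
    (hq : ∀ᵐ ξ ∂π, LipschitzWith q fun x => s x ξ) {D : ℝ} (hD : ∀ x y : X, dist x y ≤ D) :
    ∃ μ : Measure X, IsProbabilityMeasure μ ∧ μ.bind (fun x => π.map (s x)) = μ := by
  obtain ⟨x₀⟩ := ‹Nonempty X›
  set P : Measure (ℕ → Ξ) := Measure.infinitePi fun _ => π with hP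
  have hgood : ∀ᵐ ω ∂P, ∀ n, LipschitzWith q fun x => s x (ω n) := by
    refine ae_all_iff.2 fun n => ?_
    exact (measurePreserving_eval_infinitePi (fun _ : ℕ => π) n).quasiMeasurePreserving.ae hq
  -- Successive backward iterates share their outer maps and differ only in the innermost one, so
  -- each shared map contributes a factor `q`.
  have hstep : ∀ k (ω : ℕ → Ξ), (∀ n, LipschitzWith q fun x => s x (ω n)) →
      dist (backwardIter s k x₀ ω) (backwardIter s (k + 1) x₀ ω) ≤ D * (q : ℝ) ^ k := by
    intro k
    induction k with
    | zero => intro ω _; simpa using hD _ _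
    | succ k ih =>
      intro ω hω
      refine ((hω 0).dist_le_mul _ _).trans ?_
      have := ih (fun n => ω (n + 1)) fun n => hω (n + 1)
      calc (q : ℝ) * _ ≤ q * (D * (q : ℝ) ^ k) := by gcongr
        _ = _ := by ring
  have hconv : ∀ᵐ ω ∂P, ∃ l, Tendsto (fun k => backwardIter s k x₀ ω) atTop (𝓝 l) := by
    filter_upwards [hgood] with ω hω
    exact cauchySeq_tendsto_of_complete
      (cauchySeq_of_le_geometric q D (by exact_mod_cast hq1) fun k => hstep k ω hω)
  obtain ⟨B, hB, hlim⟩ := measurable_limit_of_tendsto_metrizable_ae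
    (fun k => (measurable_backwardIter hs k x₀).aemeasurable) hconv
  have hht : Measurable fun ω : ℕ → Ξ => (ω 0, fun n => ω (n + 1)) := by fun_prop
  have ht : Measurable fun (ω : ℕ → Ξ) (n : ℕ) => ω (n + 1) := by fun_prop
  have hht' := infinitePi_map_head_tail π
  have htail : P.map (fun (ω : ℕ → Ξ) (n : ℕ) => ω (n + 1)) = P := by
    have := congrArg (Measure.map Prod.snd) hht'
    rw [Measure.map_map measurable_snd hht, Measure.map_snd_prod, measure_univ, one_smul] at this
    exact this
  -- The shift preserves `P`, so almost sure convergence also holds along the shifted sequence.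
  have hlim' : ∀ᵐ ω ∂P, Tendsto (fun k => backwardIter s k x₀ fun n => ω (n + 1)) atTop
      (𝓝 (B fun n => ω (n + 1))) := by
    refine ae_of_ae_map ht.aemeasurable (p := fun ω => Tendsto (fun k => backwardIter s k x₀ ω)
      atTop (𝓝 (B ω))) ?_
    rwa [htail]
  have hfix : B =ᵐ[P] fun ω => s (B fun n => ω (n + 1)) (ω 0) := by
    filter_upwards [hgood, hlim, hlim'] with ω h1 h2 h3
    exact tendsto_nhds_unique ((tendsto_add_atTop_iff_nat 1).2 h2)
      (((h1 0).continuous.tendsto _).comp h3)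
  refine ⟨P.map B, Measure.isProbabilityMeasure_map hB.aemeasurable, ?_⟩
  have : IsProbabilityMeasure (P.map B) := Measure.isProbabilityMeasure_map hB.aemeasurable
  rw [bind_map_eq_map_prod hs]
  -- Head and tail are independent, so one step of the kernel from the law of `B` is the law of the
  -- right-hand side of `hfix`.
  have e : (P.map B).prod π = P.map fun ω => (B fun n => ω (n + 1), ω 0) := by
    have e1 := Measure.map_prod_map π P (measurable_id (α := Ξ)) hB
    rw [Measure.map_id, ← hht', Measure.map_map (by fun_prop) hht] at e1
    rw [← Measure.prod_swap, e1, Measure.map_map measurable_swap (by fun_prop)]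
    rfl
  rw [e, Measure.map_map hs (by fun_prop)]
  exact Measure.map_congr hfix.symm

end RandomMaps

end RNN

/-! ### The model -/

namespace RNN

/-! ### Norms in `L²` and `H¹` -/

lemma Lp_norm_sq_eq_integral {α E : Type*} [MeasurableSpace α] {ρ : Measure α}
    [NormedAddCommGroup E] [InnerProductSpace ℝ E] (f : Lp E 2 ρ) :
    ‖f‖ ^ 2 = ∫ a, ‖f a‖ ^ 2 ∂ρ := by
  rw [← real_inner_self_eq_norm_sq, L2.inner_def]
  simp

lemma H1.norm_sq {d : ℕ} {ρ : Measure (Vec d)} (h : H1 ρ) :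
    ‖h‖ ^ 2 = ‖(h : L2Pair ρ).fst‖ ^ 2 + ‖(h : L2Pair ρ).snd‖ ^ 2 := by
  rw [← WithLp.prod_norm_sq_eq_of_L2]
  rfl

lemma H1.norm_toFun_le {d : ℕ} {ρ : Measure (Vec d)} (h : H1 ρ) : ‖h.toFun‖ ≤ ‖h‖ := by
  refine abs_le_of_sq_le_sq' ?_ (norm_nonneg _) |>.2
  rw [H1.norm_sq]
  exact le_add_of_nonneg_right (sq_nonneg _)

namespace MemoryModel

variable {d : ℕ} (M : MemoryModel d)

/-! ### Constants and Lipschitz bounds for ridge functions -/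

lemma Cσ_nonneg : 0 ≤ M.Cσ := (abs_nonneg _).trans (M.deriv_σ_bdd 0)

lemma sq_drift_sub_le (u v : Pair d) :
    ‖M.g u - M.g v‖ ^ 2 + (M.f u - M.f v) ^ 2 ≤ M.L ^ 2 * ‖u - v‖ ^ 2 := by
  have h := pow_le_pow_left₀ (norm_nonneg _) (M.lipschitz u v) 2
  rw [WithLp.prod_norm_sq_eq_of_L2, mul_pow] at h
  simpa using h

lemma q₀_sq_lt_one : M.L ^ 2 + 8 * M.Cσ ^ 2 < 1 := by
  have := M.Cσ_sq_lt.trans_le (min_le_right _ _)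
  linarith

lemma q₀_nonneg : 0 ≤ M.q₀ := Real.sqrt_nonneg _

lemma q₀_lt_one : M.q₀ < 1 := by
  rw [q₀, Real.sqrt_lt' one_pos]
  simpa using M.q₀_sq_lt_one

lemma q₀_sq : M.q₀ ^ 2 = M.L ^ 2 + 8 * M.Cσ ^ 2 := Real.sq_sqrt (by positivity)

lemma abs_σ_sub_le (s t : ℝ) : |M.σ s - M.σ t| ≤ M.Cσ * |s - t| :=
  Convex.norm_image_sub_le_of_norm_deriv_le (s := Set.univ)
    (fun _ _ => (M.σ_contDiff.differentiable (by norm_num)) _) (fun x _ => M.deriv_σ_bdd x)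
    convex_univ (Set.mem_univ _) (Set.mem_univ _)

lemma abs_deriv_σ_sub_le (s t : ℝ) : |deriv M.σ s - deriv M.σ t| ≤ M.Cσ * |s - t| := by
  have hd : Differentiable ℝ (deriv M.σ) :=
    (contDiff_succ_iff_deriv (n := 1).1 (by exact_mod_cast M.σ_contDiff)).2.2.differentiable
      one_ne_zero
  exact Convex.norm_image_sub_le_of_norm_deriv_le (s := Set.univ)
    (fun _ _ => hd _) (fun x _ => M.deriv2_σ_bdd x)
    convex_univ (Set.mem_univ _) (Set.mem_univ _)

lemma integrable_norm_sq_lamW : Integrable (fun w => ‖w‖ ^ 2) M.lamW ∧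
    ∫ w, ‖w‖ ^ 2 ∂M.lamW ≤ 1 := by
  have hm : Measurable fun θ : ℝ × Vec d × ℝ => θ.2.1 := by fun_prop
  have h : ∫⁻ w, ENNReal.ofReal (‖w‖ ^ 2) ∂M.lamW ≤ 1 := by
    rw [lamW, lintegral_map (by fun_prop) hm]
    refine le_trans (le_of_eq (lintegral_congr fun θ => ?_)) M.lam_w_sq
    rw [ENNReal.ofReal_pow (norm_nonneg _), ofReal_norm]
  constructor
  · refine ⟨by fun_prop, ?_⟩
    rw [hasFiniteIntegral_iff_ofReal (Eventually.of_forall fun w => by positivity)]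
    exact h.trans_lt ENNReal.one_lt_top
  · rw [integral_eq_lintegral_of_nonneg_ae (Eventually.of_forall fun w => by positivity)
      (by fun_prop)]
    exact ENNReal.toReal_le_of_le_ofReal zero_le_one (by simpa using h)

/-- With `s`, `s'` the arguments of `σ`, the values cost `C_σ² (s - s')²` and the gradients `2 C_σ²
‖a - a'‖² + 2 C_σ² (s - s')²`. The `6` is this total `3` times the `2` from `(s - s')² ≤ 2(‖a - a'‖²
‖w‖² + (b - b')²)`. -/
lemma ridge_sub_pointwise_le {a a' : Vec d} (ha' : ‖a'‖ ≤ 1) (b b' : ℝ) (w : Vec d) :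
    ‖M.ridgeFun a b w - M.ridgeFun a' b' w‖ ^ 2
      + ‖(∇ (M.ridgeFun a b)) w - (∇ (M.ridgeFun a' b')) w‖ ^ 2
      ≤ 2 * M.Cσ ^ 2 * ‖a - a'‖ ^ 2
        + 6 * M.Cσ ^ 2 * (‖a - a'‖ ^ 2 * ‖w‖ ^ 2 + (b - b') ^ 2) := by
  have hC := M.Cσ_nonneg
  rw [gradient_ridgeFun, gradient_ridgeFun]
  simp only [ridgeFun]
  set s : ℝ := inner ℝ w a + b with hs
  set s' : ℝ := inner ℝ w a' + b' with hs'
  have e : s - s' = inner ℝ w (a - a') + (b - b') := by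
    rw [hs, hs', inner_sub_right]; ring
  have hin : (inner ℝ w (a - a') : ℝ) ^ 2 ≤ ‖a - a'‖ ^ 2 * ‖w‖ ^ 2 := by
    rw [← sq_abs, mul_comm, ← mul_pow]
    exact pow_le_pow_left₀ (abs_nonneg _) (abs_real_inner_le_norm _ _) 2
  have hss : (s - s') ^ 2 ≤ 2 * (‖a - a'‖ ^ 2 * ‖w‖ ^ 2 + (b - b') ^ 2) := by
    rw [e]
    nlinarith [sq_nonneg ((inner ℝ w (a - a') : ℝ) - (b - b'))]
  have h1 : ‖M.σ s - M.σ s'‖ ^ 2 ≤ M.Cσ ^ 2 * (s - s') ^ 2 := by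
    rw [Real.norm_eq_abs, ← sq_abs (s - s'), ← mul_pow]
    exact pow_le_pow_left₀ (abs_nonneg _) (M.abs_σ_sub_le s s') 2
  have h2 : ‖deriv M.σ s • a - deriv M.σ s' • a'‖ ≤ M.Cσ * ‖a - a'‖ + M.Cσ * |s - s'| := by
    -- In this splitting the difference of derivatives multiplies `a'`, so only `a'` has to lie in
    -- the unit ball.
    have e2 : deriv M.σ s • a - deriv M.σ s' • a'
        = deriv M.σ s • (a - a') + (deriv M.σ s - deriv M.σ s') • a' := by module
    rw [e2]
    refine (norm_add_le _ _).trans ?_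
    rw [norm_smul, norm_smul]
    refine add_le_add (mul_le_mul_of_nonneg_right (M.deriv_σ_bdd s) (norm_nonneg _)) ?_
    calc ‖deriv M.σ s - deriv M.σ s'‖ * ‖a'‖ ≤ (M.Cσ * |s - s'|) * 1 :=
          mul_le_mul (M.abs_deriv_σ_sub_le s s') ha' (norm_nonneg _) (by positivity)
      _ = _ := mul_one _
  have h3 : ‖deriv M.σ s • a - deriv M.σ s' • a'‖ ^ 2
      ≤ 2 * M.Cσ ^ 2 * ‖a - a'‖ ^ 2 + 2 * M.Cσ ^ 2 * (s - s') ^ 2 := by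
    refine (pow_le_pow_left₀ (norm_nonneg _) h2 2).trans ?_
    have := sq_nonneg (M.Cσ * ‖a - a'‖ - M.Cσ * |s - s'|)
    rw [← sq_abs (s - s')]
    nlinarith
  have h4 := mul_le_mul_of_nonneg_left hss (by positivity : 0 ≤ 3 * M.Cσ ^ 2)
  linarith

/-- Integrating the pointwise bound with `∫ ‖w‖² ≤ 1` gives the factor `2 + 6 = 8` for `a`; the
factor `6` for `b` is rounded up to `8`. -/
lemma norm_ridge_sub_sq_le {a a' : Vec d} (ha' : ‖a'‖ ≤ 1) (b b' : ℝ) :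
    ‖M.ridge a b - M.ridge a' b'‖ ^ 2 ≤ 8 * M.Cσ ^ 2 * (‖a - a'‖ ^ 2 + (b - b') ^ 2) := by
  have hf : MemLp (fun w => M.ridgeFun a b w - M.ridgeFun a' b' w) 2 M.lamW :=
    (M.memLp_ridgeFun a b).sub (M.memLp_ridgeFun a' b')
  have hg : MemLp (fun w => (∇ (M.ridgeFun a b)) w - (∇ (M.ridgeFun a' b')) w) 2 M.lamW :=
    (M.memLp_gradient_ridgeFun a b).sub (M.memLp_gradient_ridgeFun a' b')
  have e1 : ((M.ridge a b - M.ridge a' b' : H1 M.lamW) : L2Pair M.lamW).fst = hf.toLp _ := rfl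
  have e2 : ((M.ridge a b - M.ridge a' b' : H1 M.lamW) : L2Pair M.lamW).snd = hg.toLp _ := rfl
  have i1 := integral_congr_ae (hf.coeFn_toLp.fun_comp fun x => ‖x‖ ^ 2)
  have i2 := integral_congr_ae (hg.coeFn_toLp.fun_comp fun x => ‖x‖ ^ 2)
  simp only [Function.comp_apply] at i1 i2
  rw [H1.norm_sq, e1, e2, Lp_norm_sq_eq_integral, Lp_norm_sq_eq_integral, i1, i2,
    ← integral_add (hf.integrable_norm_pow two_ne_zero) (hg.integrable_norm_pow two_ne_zero)]
  obtain ⟨hw, hw1⟩ := M.integrable_norm_sq_lamW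
  have hJ : Integrable (fun w => ‖a - a'‖ ^ 2 * ‖w‖ ^ 2 + (b - b') ^ 2) M.lamW :=
    (hw.const_mul _).add (integrable_const _)
  have hi : Integrable (fun w => 2 * M.Cσ ^ 2 * ‖a - a'‖ ^ 2
        + 6 * M.Cσ ^ 2 * (‖a - a'‖ ^ 2 * ‖w‖ ^ 2 + (b - b') ^ 2)) M.lamW :=
    (integrable_const _).add (hJ.const_mul _)
  refine (integral_mono ((hf.integrable_norm_pow two_ne_zero).add (hg.integrable_norm_pow two_ne_zero)) hi
    (M.ridge_sub_pointwise_le ha' b b')).trans ?_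
  rw [integral_add (integrable_const _) (hJ.const_mul _),
    integral_const, integral_const_mul, integral_add (hw.const_mul _) (integrable_const _), integral_const_mul]
  simp only [integral_const, probReal_univ, smul_eq_mul, one_mul]
  have h1 := mul_le_mul_of_nonneg_left hw1
    (by positivity : 0 ≤ 6 * M.Cσ ^ 2 * ‖a - a'‖ ^ 2)
  have h2 : 0 ≤ 2 * M.Cσ ^ 2 * (b - b') ^ 2 := by positivity
  linarith

lemma measureUnivNNReal_lamW : measureUnivNNReal M.lamW = 1 := by
  simp [measureUnivNNReal]

lemma norm_ridge_sq_le {a : Vec d} (ha : ‖a‖ ≤ 1) (b : ℝ) :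
    ‖M.ridge a b‖ ^ 2 ≤ 1 + M.Cσ ^ 2 := by
  have e1 : ((M.ridge a b : H1 M.lamW) : L2Pair M.lamW).fst = (M.memLp_ridgeFun a b).toLp _ := rfl
  have e2 : ((M.ridge a b : H1 M.lamW) : L2Pair M.lamW).snd
    = (M.memLp_gradient_ridgeFun a b).toLp _ := rfl
  rw [H1.norm_sq, e1, e2]
  refine add_le_add ?_ ?_
  · refine pow_le_one₀ (norm_nonneg _) ?_
    have := Lp.norm_le_of_ae_bound (f := (M.memLp_ridgeFun a b).toLp _) zero_le_one
      ((M.memLp_ridgeFun a b).coeFn_toLp.mono fun w hw => by rw [hw]; exact M.σ_bdd _)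
    rwa [measureUnivNNReal_lamW, NNReal.coe_one, Real.one_rpow, one_mul] at this
  · refine pow_le_pow_left₀ (norm_nonneg _) ?_ 2
    have := Lp.norm_le_of_ae_bound (f := (M.memLp_gradient_ridgeFun a b).toLp _) M.Cσ_nonneg
      ((M.memLp_gradient_ridgeFun a b).coeFn_toLp.mono fun w hw => by
        rw [hw, gradient_ridgeFun, norm_smul]
        calc _ ≤ M.Cσ * 1 := mul_le_mul (M.deriv_σ_bdd _) ha (norm_nonneg _) M.Cσ_nonneg
          _ = _ := mul_one _)
    rwa [measureUnivNNReal_lamW, NNReal.coe_one, Real.one_rpow, one_mul] at this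

/-! ### The pairing with `b` -/

lemma integrable_pairing (h : H1 M.lamW) :
    Integrable (fun θ : ℝ × Vec d × ℝ => h.toFun θ.2.1) M.lam ∧
    Integrable (fun θ : ℝ × Vec d × ℝ => θ.2.2 * h.toFun θ.2.1) M.lam := by
  have hm : Measurable fun θ : ℝ × Vec d × ℝ => θ.2.1 := by fun_prop
  have h1 : Integrable (fun w => h.toFun w) M.lamW := (Lp.memLp h.toFun).integrable (by norm_num)
  have h2 : Integrable (fun θ : ℝ × Vec d × ℝ => h.toFun θ.2.1) M.lam := h1.comp_measurable hm
  exact ⟨h2, h2.bdd_mul (c := 1) (Measurable.aestronglyMeasurable (by fun_prop)) M.lam_b_bdd⟩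

lemma pairing_sub (h h' : H1 M.lamW) :
    M.pairing (h - h') = M.pairing h - M.pairing h' := by
  have hm : Measurable fun θ : ℝ × Vec d × ℝ => θ.2.1 := by fun_prop
  rw [pairing, pairing, pairing, ← integral_sub (M.integrable_pairing h).2
    (M.integrable_pairing h').2]
  refine integral_congr_ae ?_
  have e : (h - h').toFun = h.toFun - h'.toFun := rfl
  filter_upwards [ae_of_ae_map hm.aemeasurable (Lp.coeFn_sub h.toFun h'.toFun)] with θ hθ
  rw [e, hθ, Pi.sub_apply, mul_sub]

/-- Since `|b| ≤ 1`, the pairing is at most the `L¹` norm, which on a probability space is at most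
the `L²` norm, hence at most the `H¹` norm. -/
lemma abs_pairing_le (h : H1 M.lamW) : |M.pairing h| ≤ ‖h‖ := by
  have hm : Measurable fun θ : ℝ × Vec d × ℝ => θ.2.1 := by fun_prop
  have hL := Lp.memLp h.toFun
  calc |M.pairing h| ≤ ∫ θ, ‖h.toFun θ.2.1‖ ∂M.lam := by
        rw [pairing, ← Real.norm_eq_abs]
        refine norm_integral_le_of_norm_le (M.integrable_pairing h).1.norm
          (M.lam_b_bdd.mono fun θ hθ => ?_)
        rw [norm_mul]
        exact mul_le_of_le_one_left (norm_nonneg _) hθ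
    _ = ∫ w, ‖h.toFun w‖ ∂M.lamW := by
        exact (integral_map hm.aemeasurable hL.1.norm).symm
    _ = (eLpNorm h.toFun 1 M.lamW).toReal := by
        rw [eLpNorm_one_eq_lintegral_enorm, integral_norm_eq_lintegral_enorm hL.1]
    _ ≤ (eLpNorm h.toFun 2 M.lamW).toReal :=
        ENNReal.toReal_mono hL.2.ne (eLpNorm_le_eLpNorm_of_exponent_le (by norm_num) hL.1)
    _ ≤ ‖h‖ := h.norm_toFun_le

/-! ### Contraction and continuity of `F` -/

lemma norm_sq_ambient (p : M.Ambient) :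
    ‖p‖ ^ 2 = ‖p.fst‖ ^ 2 + (p.snd.fst ^ 2 + ‖p.snd.snd‖ ^ 2) := by
  rw [WithLp.prod_norm_sq_eq_of_L2, WithLp.prod_norm_sq_eq_of_L2 p.snd, Real.norm_eq_abs, sq_abs]

/-- The common noise cancels, leaving the drift bound plus the ridge bound with `a = x` and `b` the
pairing, which is linear and `1`-Lipschitz in `h`. -/
lemma norm_F_sub_sq_le {p p' : M.Ambient} (hp' : p' ∈ M.stateSet) (ξ : Pair d × ℝ) :
    ‖M.F p ξ - M.F p' ξ‖ ^ 2 ≤ M.q₀ ^ 2 * ‖p - p'‖ ^ 2 := by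
  have hx : ‖p'.fst.fst‖ ≤ 1 := (WithLp.norm_fst_le _ _).trans hp'.1
  have h1 := M.sq_drift_sub_le p.fst p'.fst
  have h2 := M.norm_ridge_sub_sq_le (a := p.fst.fst) hx (M.pairing p.snd.snd)
    (M.pairing p'.snd.snd)
  have h3 : (M.pairing p.snd.snd - M.pairing p'.snd.snd) ^ 2 ≤ ‖p.snd.snd - p'.snd.snd‖ ^ 2 := by
    rw [← pairing_sub, ← sq_abs]
    exact pow_le_pow_left₀ (abs_nonneg _) (M.abs_pairing_le _) 2
  have h4 : ‖p.fst.fst - p'.fst.fst‖ ^ 2 ≤ ‖p.fst - p'.fst‖ ^ 2 :=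
    pow_le_pow_left₀ (norm_nonneg _) (WithLp.norm_fst_le _ (p.fst - p'.fst)) 2
  have e : ‖M.F p ξ - M.F p' ξ‖ ^ 2 = ‖M.g p.fst - M.g p'.fst‖ ^ 2 + ((M.f p.fst - M.f p'.fst) ^ 2
      + ‖M.memoryUpdate p - M.memoryUpdate p'‖ ^ 2) := by
    have e1 : (M.F p ξ - M.F p' ξ).fst = M.g p.fst - M.g p'.fst := add_sub_add_right_eq_sub _ _ _
    have e2 : (M.F p ξ - M.F p' ξ).snd.fst = M.f p.fst - M.f p'.fst :=
      add_sub_add_right_eq_sub _ _ _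
    have e3 : (M.F p ξ - M.F p' ξ).snd.snd = M.memoryUpdate p - M.memoryUpdate p' := rfl
    rw [norm_sq_ambient, e1, e2, e3]
  have e' : ‖p - p'‖ ^ 2 = ‖p.fst - p'.fst‖ ^ 2 + ((p.snd.fst - p'.snd.fst) ^ 2
      + ‖p.snd.snd - p'.snd.snd‖ ^ 2) := M.norm_sq_ambient (p - p')
  rw [e, e', q₀_sq]
  simp only [memoryUpdate]
  have h5 := mul_le_mul_of_nonneg_left (add_le_add h4 h3) (by positivity : 0 ≤ 8 * M.Cσ ^ 2)
  -- `F` does not depend on `y`, and `h` enters only with the factor `8 C_σ²`; these two terms are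
  -- the slack up to `q₀² ‖p - p'‖²`.
  have h6 : 0 ≤ (M.L ^ 2 + 8 * M.Cσ ^ 2) * (p.snd.fst - p'.snd.fst) ^ 2 := by positivity
  have h7 : 0 ≤ M.L ^ 2 * ‖p.snd.snd - p'.snd.snd‖ ^ 2 := by positivity
  linarith

lemma norm_F_sub_le {p p' : M.Ambient} (hp' : p' ∈ M.stateSet) (ξ : Pair d × ℝ) :
    ‖M.F p ξ - M.F p' ξ‖ ≤ M.q₀ * ‖p - p'‖ := by
  refine abs_le_of_sq_le_sq' ?_ (mul_nonneg M.q₀_nonneg (norm_nonneg _)) |>.2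
  rw [mul_pow]
  exact M.norm_F_sub_sq_le hp' ξ

lemma F_eq_add (p : M.Ambient) (ξ : Pair d × ℝ) :
    M.F p ξ = M.F p 0 + WithLp.toLp 2 (ξ.1, WithLp.toLp 2 (ξ.2, 0)) := by
  simp [F, ← WithLp.toLp_add]

/-- The noise is additive, so joint continuity reduces to the Lipschitz bound in the state at zero
noise. -/
lemma continuous_F : Continuous fun q : M.State × (Pair d × ℝ) => M.F q.1 q.2 := by
  have h0 : Continuous fun H : M.State => M.F H 0 :=
    (LipschitzWith.of_dist_le_mul (K := M.q₀.toNNReal) fun H H' => by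
      rw [Real.coe_toNNReal _ M.q₀_nonneg, dist_eq_norm, Subtype.dist_eq, dist_eq_norm]
      exact M.norm_F_sub_le H'.2 0).continuous
  have h1 : Continuous fun ξ : Pair d × ℝ =>
      (WithLp.toLp 2 (ξ.1, WithLp.toLp 2 (ξ.2, 0)) : M.Ambient) := by
    refine (WithLp.prod_continuous_toLp 2 _ _).comp (continuous_fst.prodMk ?_)
    exact (WithLp.prod_continuous_toLp 2 _ _).comp (continuous_snd.prodMk continuous_const)
  refine ((h0.comp continuous_fst).add (h1.comp continuous_snd)).congr fun q => ?_
  exact (M.F_eq_add q.1 q.2).symm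

/-! ### The state space and the step map -/

lemma isClosed_stateSet : IsClosed M.stateSet := by
  have h1 : IsClosed {p : M.Ambient | ‖p.fst‖ ≤ 1} :=
    isClosed_le (by fun_prop) continuous_const
  have h2 : IsClosed {p : M.Ambient | |p.snd.fst| ≤ M.Cy} :=
    isClosed_le (by fun_prop) continuous_const
  have h3 : IsClosed {p : M.Ambient | p.snd.snd ∈ closure M.hidden} :=
    isClosed_closure.preimage (by fun_prop)
  exact h1.inter (h2.inter h3)

instance : CompleteSpace M.State := M.isClosed_stateSet.isComplete.completeSpace_coe

/-- Inherited from separable `L²` spaces. It makes Borel and product `σ`-algebras agree on products,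
so distances and continuous maps there are measurable. -/
instance : SecondCountableTopology (H1 M.lamW) := by
  have : Fact ((2 : ℝ≥0∞) ≠ ∞) := ⟨by norm_num⟩
  have : SecondCountableTopology (Lp ℝ 2 M.lamW) := inferInstance
  have : SecondCountableTopology (Lp (Vec d) 2 M.lamW) := inferInstance
  have : SecondCountableTopology (L2Pair M.lamW) := WithLp.secondCountableTopology 2 _ _
  exact TopologicalSpace.Subtype.secondCountableTopology _

instance : SecondCountableTopology M.Ambient :=
  have : SecondCountableTopology (WithLp 2 (ℝ × H1 M.lamW)) :=
    WithLp.secondCountableTopology 2 _ _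
  WithLp.secondCountableTopology 2 _ _

lemma ae_F_mem (H : M.State) : ∀ᵐ ξ ∂M.noise, M.F H ξ ∈ M.stateSet := by
  filter_upwards [M.input_bdd _ H.2.1, M.output_bdd _ H.2.1] with ξ h1 h2
  exact ⟨h1, h2, subset_closure ⟨_, _, (WithLp.norm_fst_le _ _).trans H.2.1, rfl⟩⟩

/-- The exceptional null set a priori depends on `H`. A countable dense set of states gives a common
one, and continuity of `F` with closedness of the state set extends it to all states. Otherwise
`step` could not be Lipschitz for almost every fixed noise. -/
lemma ae_forall_F_mem : ∀ᵐ ξ ∂M.noise, ∀ H : M.State, M.F H ξ ∈ M.stateSet := by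
  obtain ⟨S, hS, hSd⟩ := TopologicalSpace.exists_countable_dense M.State
  filter_upwards [(ae_ball_iff hS).2 fun H _ => M.ae_F_mem H] with ξ hξ
  have hc : Continuous fun H : M.State => M.F H ξ :=
    M.continuous_F.comp (continuous_id.prodMk continuous_const)
  intro H
  have hcl : IsClosed ((fun H : M.State => M.F H ξ) ⁻¹' M.stateSet) :=
    M.isClosed_stateSet.preimage hc
  exact hcl.closure_subset_iff.2 hξ (hSd H)

lemma coe_step_of_mem {H : M.State} {ξ : Pair d × ℝ} (h : M.F H ξ ∈ M.stateSet) :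
    (M.step H ξ : M.Ambient) = M.F H ξ := by
  rw [step, dif_pos h]

lemma measurable_step : Measurable (Function.uncurry M.step) := by
  borelize M.Ambient
  have hF := M.continuous_F.measurable
  have hs : MeasurableSet {q : M.State × (Pair d × ℝ) | M.F q.1 q.2 ∈ M.stateSet} :=
    hF M.isClosed_stateSet.measurableSet
  classical
  have hval : Measurable fun q : M.State × (Pair d × ℝ) => (M.step q.1 q.2 : M.Ambient) := by
    have e : (fun q : M.State × (Pair d × ℝ) => (M.step q.1 q.2 : M.Ambient))
        = fun q => if M.F q.1 q.2 ∈ M.stateSet then M.F q.1 q.2 else q.1 := by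
      funext q
      rw [step]
      split_ifs <;> rfl
    rw [e]
    exact Measurable.ite hs hF (continuous_subtype_val.measurable.comp measurable_fst)
  exact (Topology.IsClosedEmbedding.measurableEmbedding
    M.isClosed_stateSet.isClosedEmbedding_subtypeVal).measurable_comp_iff.1 hval

lemma ae_lipschitz_step :
    ∀ᵐ ξ ∂M.noise, LipschitzWith M.q₀.toNNReal fun H => M.step H ξ := by
  filter_upwards [M.ae_forall_F_mem] with ξ hξ
  refine LipschitzWith.of_dist_le_mul fun H H' => ?_
  rw [Real.coe_toNNReal _ M.q₀_nonneg, Subtype.dist_eq, Subtype.dist_eq, dist_eq_norm,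
    dist_eq_norm, M.coe_step_of_mem (hξ H), M.coe_step_of_mem (hξ H')]
  exact M.norm_F_sub_le H'.2 ξ

lemma norm_sq_le_of_mem_closure_hidden {h : H1 M.lamW} (hh : h ∈ closure M.hidden) :
    ‖h‖ ^ 2 ≤ 1 + M.Cσ ^ 2 := by
  have hc : IsClosed {h : H1 M.lamW | ‖h‖ ^ 2 ≤ 1 + M.Cσ ^ 2} :=
    isClosed_le (by fun_prop) continuous_const
  refine hc.closure_subset_iff.2 ?_ hh
  rintro _ ⟨a, b, ha, rfl⟩
  exact M.norm_ridge_sq_le ha b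

/-- Boundedness makes second moments and Wasserstein distances finite for every probability measure
on the state space. -/
lemma exists_norm_state_le : ∃ R : ℝ≥0, ∀ H : M.State, ‖(H : M.Ambient)‖ ≤ R := by
  refine ⟨Real.toNNReal √(1 + (M.Cy ^ 2 + (1 + M.Cσ ^ 2))), fun H => ?_⟩
  rw [Real.coe_toNNReal _ (Real.sqrt_nonneg _)]
  refine Real.le_sqrt_of_sq_le ?_
  rw [norm_sq_ambient, ← sq_abs (H : M.Ambient).snd.fst]
  refine add_le_add (pow_le_one₀ (norm_nonneg _) H.2.1)
    (add_le_add (pow_le_pow_left₀ (abs_nonneg _) H.2.2.1 2)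
      (M.norm_sq_le_of_mem_closure_hidden H.2.2.2))

lemma exists_dist_state_le : ∃ D : ℝ≥0, ∀ H H' : M.State, dist H H' ≤ D := by
  obtain ⟨R, hR⟩ := M.exists_norm_state_le
  refine ⟨R + R, fun H H' => ?_⟩
  rw [Subtype.dist_eq, dist_eq_norm]
  exact (norm_sub_le _ _).trans (add_le_add (hR H) (hR H'))

instance : Nonempty M.State := by
  have := M.noise_prob
  -- One admissible noise is enough to see that `C_y` is nonnegative, so that `y = 0` is allowed.
  obtain ⟨ξ, hξ⟩ := (M.output_bdd 0 (by simp)).exists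
  refine ⟨⟨WithLp.toLp 2 (0, WithLp.toLp 2 (0, M.ridge 0 0)), ?_, ?_, ?_⟩⟩
  · simp
  · simpa using (abs_nonneg _).trans hξ
  · exact subset_closure ⟨0, 0, by simp, rfl⟩

lemma mem_P2 (μ : Measure M.State) [IsProbabilityMeasure μ] : μ ∈ M.P2 := by
  obtain ⟨R, hR⟩ := M.exists_norm_state_le
  refine ⟨inferInstance, ?_⟩
  calc ∫⁻ u, ‖(u : M.Ambient)‖ₑ ^ 2 ∂μ ≤ ∫⁻ _, (R : ℝ≥0∞) ^ 2 ∂μ :=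
        lintegral_mono fun u => pow_le_pow_left' (by
          rw [enorm_le_coe]
          exact hR u) 2
    _ < ∞ := by simp

/-! ### The operator on laws, uniqueness and the chain -/

lemma isProbabilityMeasure_dual (μ : Measure M.State) [IsProbabilityMeasure μ] :
    IsProbabilityMeasure (M.dual μ) :=
  have := M.noise_prob
  isProbabilityMeasure_bind_map M.measurable_step M.noise μ

lemma wass2_dual_le (μ ν : Measure M.State) [IsProbabilityMeasure μ] [IsProbabilityMeasure ν] :
    wass2 (M.dual μ) (M.dual ν) ≤ ENNReal.ofReal M.q₀ * wass2 μ ν :=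
  have := M.noise_prob
  wass2_bind_map_le M.measurable_step M.noise M.ae_lipschitz_step μ ν

lemma wass2_state_lt_top (μ ν : Measure M.State) [IsProbabilityMeasure μ]
    [IsProbabilityMeasure ν] : wass2 μ ν < ∞ := by
  obtain ⟨D, hD⟩ := M.exists_dist_state_le
  exact wass2_lt_top (fun x y => by
    rw [edist_nndist]; exact_mod_cast hD x y) μ ν

lemma eq_of_dual_eq {μ ν : Measure M.State} [IsProbabilityMeasure μ] [IsProbabilityMeasure ν]
    (hμ : M.dual μ = μ) (hν : M.dual ν = ν) : ν = μ := by
  refine eq_of_wass2_eq_zero ?_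
  by_contra h0
  have h := M.wass2_dual_le ν μ
  rw [hμ, hν] at h
  -- The strict inequality needs the distance to be finite as well as nonzero.
  have hlt : ENNReal.ofReal M.q₀ * wass2 ν μ < 1 * wass2 ν μ :=
    ENNReal.mul_lt_mul_left h0 (M.wass2_state_lt_top ν μ).ne (by simpa using M.q₀_lt_one)
  rw [one_mul] at hlt
  exact absurd h hlt.not_ge

lemma wass2_iterate_dual_le {μ : Measure M.State} [IsProbabilityMeasure μ] (hμ : M.dual μ = μ)
    (k : ℕ) (μ₀ : Measure M.State) [IsProbabilityMeasure μ₀] :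
    wass2 (M.dual^[k] μ₀) μ ≤ ENNReal.ofReal M.q₀ ^ k * wass2 μ₀ μ := by
  induction k generalizing μ₀ with
  | zero => simp
  | succ k ih =>
    have := M.isProbabilityMeasure_dual μ₀
    rw [Function.iterate_succ_apply, pow_succ, mul_assoc]
    refine (ih (M.dual μ₀)).trans (mul_le_mul_right ?_ _)
    simpa only [hμ] using M.wass2_dual_le μ₀ μ

lemma map_chain {Ω : Type*} [MeasurableSpace Ω] {P : Measure Ω} [IsProbabilityMeasure P]
    {H : ℕ → Ω → M.State} {ξ : ℕ → Ω → Pair d × ℝ} (h : M.IsMemoryChain P H ξ) (k : ℕ) :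
    P.map (H k) = M.dual^[k] (P.map (H 0)) := by
  have := M.noise_prob
  have : IsProbabilityMeasure (P.map (H 0)) :=
    Measure.isProbabilityMeasure_map (h.measurable_state 0).aemeasurable
  have hξ : Measurable fun ω k => ξ k ω := measurable_pi_iff.2 h.measurable_noise
  have hit : ∀ᵐ ω ∂P, H k ω = forwardIter M.step k (H 0 ω) fun n => ξ n ω := by
    induction k with
    | zero => exact Eventually.of_forall fun ω => rfl
    | succ k ih =>
      filter_upwards [ih, h.recursion k] with ω h1 h2
      -- The chain takes values in the state space, so its recursion already rules out the default
      -- branch of `step`.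
      have hm : M.F (H k ω) (ξ k ω) ∈ M.stateSet := h2 ▸ (H (k + 1) ω).2
      rw [forwardIter_succ', ← h1]
      exact Subtype.ext (h2.trans (M.coe_step_of_mem hm).symm)
  have hlaw : P.map (fun ω k => ξ k ω) = Measure.infinitePi fun _ => M.noise := by
    rw [h.indep_noise.map_fun_eq_infinitePi_map h.measurable_noise]
    simp_rw [h.law_noise]
  have hjoint : P.map (fun ω => (H 0 ω, fun k => ξ k ω))
      = (P.map (H 0)).prod (Measure.infinitePi fun _ => M.noise) := by
    rw [← hlaw]
    exact (indepFun_iff_map_prod_eq_prod_map_map (h.measurable_state 0).aemeasurable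
      hξ.aemeasurable).1 h.indep_init
  have hmap := map_forwardIter M.measurable_step M.noise k (P.map (H 0))
  rw [← hjoint, Measure.map_map (measurable_forwardIter M.measurable_step k)
    ((h.measurable_state 0).prodMk hξ)] at hmap
  exact (Measure.map_congr hit).trans hmap

end MemoryModel

end RNN

theorem theorem3p3 {d : ℕ} (M : RNN.MemoryModel d) :
    -- the transition kernel is a Markov kernel on the state space
    Measurable M.transition ∧ (∀ H : M.State, IsProbabilityMeasure (M.transition H)) ∧
    -- strict contraction
    M.q₀ < 1 ∧
    (∀ μ ∈ M.P2, M.dual μ ∈ M.P2) ∧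
    (∀ μ ∈ M.P2, ∀ ν ∈ M.P2,
      RNN.wass2 (M.dual μ) (M.dual ν) ≤ ENNReal.ofReal M.q₀ * RNN.wass2 μ ν) ∧
    -- the unique stationary measure and geometric convergence to it
    ∃ μ ∈ M.P2, M.dual μ = μ ∧
      (∀ ν : Measure M.State, IsProbabilityMeasure ν → M.dual ν = ν → ν = μ) ∧
      (∀ μ₀ : Measure M.State, IsProbabilityMeasure μ₀ →
        RNN.wass2 μ₀ μ < ∞ ∧
        ∀ k : ℕ, RNN.wass2 (M.dual^[k] μ₀) μ ≤ ENNReal.ofReal M.q₀ ^ k * RNN.wass2 μ₀ μ) ∧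
      (∀ (Ω : Type*) [MeasurableSpace Ω] (P : Measure Ω) [IsProbabilityMeasure P]
        (H : ℕ → Ω → M.State) (ξ : ℕ → Ω → RNN.Pair d × ℝ), M.IsMemoryChain P H ξ →
        (∀ k : ℕ, P.map (H k) = M.dual^[k] (P.map (H 0)) ∧
          RNN.wass2 (P.map (H k)) μ ≤
            ENNReal.ofReal M.q₀ ^ k * RNN.wass2 (P.map (H 0)) μ) ∧
        Tendsto (fun k => RNN.wass2 (P.map (H k)) μ) atTop (𝓝 0)) := by
  have := M.noise_prob
  obtain ⟨D, hD⟩ := M.exists_dist_state_le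
  obtain ⟨μ, hμp, hμ⟩ := RNN.exists_stationary M.measurable_step M.noise
    (Real.toNNReal_lt_one.2 M.q₀_lt_one) M.ae_lipschitz_step hD
  refine ⟨RNN.measurable_map_apply M.measurable_step M.noise, fun H =>
    Measure.isProbabilityMeasure_map (M.measurable_step.comp measurable_prodMk_left).aemeasurable,
    M.q₀_lt_one, fun ν hν => ?_, fun ν hν ρ hρ => ?_, μ, M.mem_P2 μ, hμ,
    fun ν _ hν => M.eq_of_dual_eq hμ hν,
    fun μ₀ _ => ⟨M.wass2_state_lt_top μ₀ μ, fun k => M.wass2_iterate_dual_le hμ k μ₀⟩, ?_⟩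
  · have := hν.1
    have := M.isProbabilityMeasure_dual ν
    exact M.mem_P2 _
  · have := hν.1
    have := hρ.1
    exact M.wass2_dual_le ν ρ
  intro Ω _ P _ H ξ h
  have : IsProbabilityMeasure (P.map (H 0)) :=
    Measure.isProbabilityMeasure_map (h.measurable_state 0).aemeasurable
  have hk : ∀ k, RNN.wass2 (P.map (H k)) μ
      ≤ ENNReal.ofReal M.q₀ ^ k * RNN.wass2 (P.map (H 0)) μ := fun k =>
    (M.map_chain h k) ▸ M.wass2_iterate_dual_le hμ k (P.map (H 0))
  refine ⟨fun k => ⟨M.map_chain h k, hk k⟩, ?_⟩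
  have ht : Tendsto (fun k => ENNReal.ofReal M.q₀ ^ k * RNN.wass2 (P.map (H 0)) μ) atTop (𝓝 0) := by
    have := ENNReal.Tendsto.mul_const (b := RNN.wass2 (P.map (H 0)) μ)
      (ENNReal.tendsto_pow_atTop_nhds_zero_of_lt_one
        (ENNReal.ofReal_lt_one.2 M.q₀_lt_one)) (Or.inr (M.wass2_state_lt_top _ μ).ne)
    rwa [zero_mul] at this
  exact tendsto_of_tendsto_of_tendsto_of_le_of_le tendsto_const_nhds ht (fun _ => zero_le) hk
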